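/- Let $n=2^k$ with $k\ge 2$, and let $T_{4n}=\langle a,b\mid a^{2n}=1,\ a^n=b^2,\ b^{-1}ab=a^{-1}\rangle$ be the dicyclic group of order $4n$. For an inverse-closed subset $S\subseteq T_{4n}\setminus\{1\}$ let $\mathrm{Cay}(T_{4n},S)$ be the graph with vertex set $T_{4n}$ and edges $\{g,sg\}$, $g\in T_{4n}$, $s\in S$. For a finite simple graph with adjacency matrix $A$ put $H(t)=\exp(\mathrm{i}tA)$, $t\in\mathbb R$, and let $\mathbf e_u$ be the standard basis vector indexed by the vertex $u$. The graph admits *pretty good state transfer* (PGST) if there are distinct vertices $u,v$, a sequence $(t_j)$ of real numbers and $\gamma\in\mathbb C$ with $|\gamma|=1$ such that $\lim_{j\to\infty}H(t_j)\mathbf e_u=\gamma\,\mathbf e_v$. It admits *pretty good fractional revival* (PGFR) if there are distinct vertices $u,v$, a sequence $(t_j)$ of real numbers and $\alpha,\beta\in\mathbb C$ with $|\alpha|^2+|\beta|^2=1$ and $\beta\neq0$ such that $\lim_{j\to\infty}H(t_j)\mathbf e_u=\alpha\,\mathbf e_u+\beta\,\mathbf e_v$. Let $S=S_1\cup\langle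 a\rangle b$ with $S_1\subseteq\langle a\rangle$. Then $\mathrm{Cay}(T_{4n},S)$ admits PGST, and hence PGFR, in each of the following two cases: 1. $S_1=\{a^{k_1},a^{-k_1}\}$, where $k_1$ is odd and $1\le k_1\le n-1$; 2. $S_1=\{a^{k_1},a^{-k_1}\}\cup\bigcup_{j=1}^{r}\{a^{2^{m_j}z}: z \text{ odd},\ 1\le z\le 2^{k-m_j+1}-1\}$, where $k_1$ is odd, $1\le k_1\le n-1$, and $1\le m_1<\cdots<m_r\le k$. -/

import Mathlib

open Filter Topology
open scoped Matrix

namespace QuantumWalk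

/-- The Cayley graph `Cay(G, S)` with edges `{g, s * g}`, `g ∈ G`, `s ∈ S` (loops, which could only
come from `1 ∈ S`, are discarded). -/
def cayleyGraph {G : Type*} [Group G] (S : Set G) : SimpleGraph G :=
  SimpleGraph.fromRel fun g h => ∃ s ∈ S, s * g = h

section Transfer

variable {V : Type*} [Fintype V] [DecidableEq V]

open Classical in
/-- The transition matrix `H(t) = exp(i t A)` of a finite graph with adjacency matrix `A`. -/
noncomputable def transitionMatrix (Γ : SimpleGraph V) (t : ℝ) : Matrix V V ℂ :=
  NormedSpace.exp ((Complex.I * (t : ℂ)) • Γ.adjMatrix ℂ)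

/-- The standard basis vector `e_u`. -/
def stdVec (u : V) : V → ℂ := Pi.single u 1

/-- Pretty good state transfer from the vertex `u` to the vertex `v`. -/
def HasPGST (Γ : SimpleGraph V) (u v : V) : Prop :=
  ∃ (t : ℕ → ℝ) (γ : ℂ), ‖γ‖ = 1 ∧
    Tendsto (fun j => transitionMatrix Γ (t j) *ᵥ stdVec u) atTop (𝓝 (γ • stdVec v))

/-- (Proper) pretty good fractional revival from the vertex `u` to the vertex `v`; the degenerate
case `β = 0` (approximate periodicity) is excluded. -/
def HasPGFR (Γ : SimpleGraph V) (u v : V) : Prop :=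
  ∃ (t : ℕ → ℝ) (α β : ℂ), ‖α‖ ^ 2 + ‖β‖ ^ 2 = 1 ∧ β ≠ 0 ∧
    Tendsto (fun j => transitionMatrix Γ (t j) *ᵥ stdVec u) atTop
      (𝓝 (α • stdVec u + β • stdVec v))

/-- The graph admits pretty good state transfer between some two distinct vertices. -/
def AdmitsPGST (Γ : SimpleGraph V) : Prop := ∃ u v : V, u ≠ v ∧ HasPGST Γ u v

/-- The graph admits pretty good fractional revival between some two distinct vertices. -/
def AdmitsPGFR (Γ : SimpleGraph V) : Prop := ∃ u v : V, u ≠ v ∧ HasPGFR Γ u v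

end Transfer

/-- The generator `a` of the dicyclic group `T_{4n} = ⟨a, b | a^{2n} = 1, a^n = b^2,
b⁻¹ a b = a⁻¹⟩`, which is Mathlib's `QuaternionGroup n`. -/
def genA (n : ℕ) : QuaternionGroup n := QuaternionGroup.a 1

/-- The generator `b` of the dicyclic group `T_{4n}`. -/
def genB (n : ℕ) : QuaternionGroup n := QuaternionGroup.xa 0

/-- The coset `⟨a⟩ b` of the dicyclic group. -/
def cosetB (n : ℕ) : Set (QuaternionGroup n) :=
  {g | ∃ x ∈ Subgroup.zpowers (genA n), g = x * genB n}

end QuantumWalk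

/-!
Put `n = 2 ^ k`. Each character `ψ` of `⟨a⟩`, extended to `T_{4n}` with a sign on the coset `⟨a⟩b`,
is an eigenvector of the Cayley graph. Its eigenvalue is `2 Re ψ(a^{k₁})` plus an integer, since
the sum of `ψ` over the elements of a given order is an integer. Expanding the standard basis
vectors at `1` and `a^n` in these eigenvectors, the coefficients differ by the factors
`ψ(a^n) = ±1`, so state transfer from `1` to `a^n` amounts to approximating these signs
simultaneously by the phases `exp(i t θ_ψ)`. By Kronecker's theorem it suffices that the signs
satisfy every multiplicative relation coming from an integer relation between the eigenvalues `θ_ψ`.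

Write `ψ(a) = ζ^e` with `ζ` a primitive `2n`-th root of unity, so that `ψ(a^n) = (-1)^e`. A
relation between the eigenvalues says that `∑ m_ψ (ζ^{e k₁} + ζ^{-e k₁})` is an integer, and the
claim is that `∑ m_ψ e` is even. Modulo `2` the minimal polynomial of `ζ` is `(X - 1)^n`; as
`2 < n`, the second Taylor coefficient at `1` of the relation is even, and
`C(e, 2) + C(-e, 2) ≡ e (mod 2)`.
-/

namespace QuantumWalk

section Kronecker

open MeasureTheory UnitAddTorus

variable {d : Type*} [Fintype d]

theorem mFourier_apply_eq_prod_toCircle (m : d → ℤ) (x : UnitAddTorus d) :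
    mFourier m x = (∏ i, (x i).toCircle ^ m i : Circle) := by
  simp only [mFourier, ContinuousMap.coe_mk, fourier_apply, AddCircle.toCircle_zsmul]
  exact (map_prod Circle.coeHom (fun i => (x i).toCircle ^ m i) _).symm

theorem mFourier_add_apply (m : d → ℤ) (x y : UnitAddTorus d) :
    mFourier m (x + y) = mFourier m x * mFourier m y := by
  simp [mFourier_apply_eq_prod_toCircle, AddCircle.toCircle_add, mul_zpow,
    Finset.prod_mul_distrib]

theorem measure_ext_of_integral_mFourier_eq {μ ν : Measure (UnitAddTorus d)} [IsFiniteMeasure μ]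
    [IsFiniteMeasure ν] (h : ∀ m : d → ℤ, ∫ x, mFourier m x ∂μ = ∫ x, mFourier m x ∂ν) :
    μ = ν := by
  have integrable (ρ : Measure (UnitAddTorus d)) [IsFiniteMeasure ρ] (f : C(UnitAddTorus d, ℂ)) :
      Integrable f ρ :=
    f.continuous.integrable_of_hasCompactSupport (HasCompactSupport.of_compactSpace _)
  refine ext_of_forall_mem_subalgebra_integral_eq_of_polish
    (A := (mFourierSubalgebra d).comap (BoundedContinuousFunction.toContinuousMapStarₐ ℂ)) ?_ ?_
  · intro x y hxy
    obtain ⟨_, ⟨f, hf, rfl⟩, hne⟩ := mFourierSubalgebra_separatesPoints hxy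
    exact ⟨f, ⟨f, ⟨BoundedContinuousFunction.mkOfCompact f, hf, rfl⟩, rfl⟩, hne⟩
  · intro g hg
    suffices ∀ f ∈ Submodule.span ℂ (Set.range mFourier), ∫ x, f x ∂μ = ∫ x, f x ∂ν by
      refine this g.toContinuousMap ?_
      rw [← mFourierSubalgebra_coe]
      exact hg
    intro f hf
    induction hf using Submodule.span_induction with
    | mem f hf =>
      obtain ⟨m, rfl⟩ := hf
      exact h m
    | zero => simp
    | add f f' _ _ ihf ihf' =>
      simp only [ContinuousMap.add_apply, integral_add (integrable _ f) (integrable _ f'), ihf,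
        ihf']
    | smul c f _ ih => simp only [ContinuousMap.smul_apply, integral_smul, ih]

theorem integral_mFourier_map_add_left (μ : Measure (UnitAddTorus d)) (m : d → ℤ)
    (x : UnitAddTorus d) :
    ∫ z, mFourier m z ∂(μ.map (x + ·)) = mFourier m x * ∫ z, mFourier m z ∂μ := by
  rw [integral_map (by fun_prop) (by fun_prop)]
  simp only [mFourier_add_apply, integral_const_mul]

theorem exists_isProbabilityMeasure_map_add_left_eq {G : Type*} [AddGroup G] [TopologicalSpace G]
    [IsTopologicalAddGroup G] [CompactSpace G] [MeasurableSpace G] [BorelSpace G]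
    (H : AddSubgroup G) (hH : IsClosed (H : Set G)) :
    ∃ μ : Measure G, IsProbabilityMeasure μ ∧ μ H = 1 ∧ ∀ x ∈ H, μ.map (x + ·) = μ := by
  have : CompactSpace H := isCompact_iff_compactSpace.1 hH.isCompact
  let ν : Measure H := Measure.addHaarMeasure ⊤
  have : IsProbabilityMeasure ν := ⟨Measure.addHaarMeasure_self⟩
  have hval : Measurable (Subtype.val : H → G) := measurable_subtype_coe
  refine ⟨ν.map Subtype.val, Measure.isProbabilityMeasure_map hval.aemeasurable, ?_, ?_⟩
  · rw [Measure.map_apply hval hH.measurableSet]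
    exact (congrArg ν (Subtype.coe_preimage_self _)).trans measure_univ
  · intro x hx
    rw [Measure.map_map (by fun_prop) hval]
    conv_rhs => rw [← map_add_left_eq_self ν ⟨x, hx⟩, Measure.map_map hval (by fun_prop)]
    rfl

/-- The Haar measure of the closure of `K` and its translate by `y` have the same Fourier
coefficients, hence agree; as the first one lives on the closure, so does `y`. -/
theorem mem_topologicalClosure_of_mFourier_eq_one (K : AddSubgroup (UnitAddTorus d))
    {y : UnitAddTorus d}
    (hy : ∀ m : d → ℤ, (∀ x ∈ K, mFourier m x = 1) → mFourier m y = 1) :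
    y ∈ K.topologicalClosure := by
  have hclosed := K.isClosed_topologicalClosure
  obtain ⟨μ, _, hμ, hinv⟩ := exists_isProbabilityMeasure_map_add_left_eq _ hclosed
  have : IsProbabilityMeasure (μ.map (y + ·)) :=
    Measure.isProbabilityMeasure_map (by fun_prop)
  have htranslate : μ.map (y + ·) = μ := by
    refine measure_ext_of_integral_mFourier_eq fun m => ?_
    rw [integral_mFourier_map_add_left]
    by_cases hm : ∀ x ∈ K, mFourier m x = 1
    · rw [hy m hm, one_mul]
    · push Not at hm
      obtain ⟨x, hx, hx1⟩ := hm
      have hzero : ∫ z, mFourier m z ∂μ = 0 := by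
        have := integral_mFourier_map_add_left μ m x
        rw [hinv x (K.le_topologicalClosure hx)] at this
        exact by_contra fun h0 => hx1 ((right_eq_mul₀ h0).1 this)
      rw [hzero, mul_zero]
  have hmem : ∀ᵐ z ∂μ, z ∈ K.topologicalClosure :=
    (prob_compl_eq_zero_iff hclosed.measurableSet).2 hμ
  have hmem_translate : ∀ᵐ z ∂μ, y + z ∈ K.topologicalClosure :=
    ae_of_ae_map (by fun_prop) (htranslate.symm ▸ hmem)
  obtain ⟨z, hz, hyz⟩ := (hmem.and hmem_translate).exists
  exact (add_mem_cancel_right hz).1 hyz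

theorem exists_tendsto_circleExp_mul (θ : d → ℝ) (z : d → Circle)
    (h : ∀ m : d → ℤ, ∑ i, m i * θ i = 0 → ∏ i, z i ^ m i = 1) :
    ∃ t : ℕ → ℝ, ∀ i, Tendsto (fun l => Circle.exp (t l * θ i)) atTop (𝓝 (z i)) := by
  let flow : ℝ →+ UnitAddTorus d :=
    { toFun := fun t i => ((t * θ i / (2 * Real.pi) : ℝ) : UnitAddCircle)
      map_zero' := by ext; simp
      map_add' := fun s t => by ext; simp [add_mul, add_div] }
  let y : UnitAddTorus d := fun i => (AddCircle.homeomorphCircle one_ne_zero).symm (z i)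
  have toCircle_flow (t : ℝ) (i : d) : (flow t i).toCircle = Circle.exp (t * θ i) := by
    refine (AddCircle.toCircle_apply_mk _).trans (congrArg _ ?_)
    field_simp
  have toCircle_y (i : d) : (y i).toCircle = z i := by
    rw [← AddCircle.homeomorphCircle_apply one_ne_zero, Homeomorph.apply_symm_apply]
  have hmem : y ∈ flow.range.topologicalClosure := by
    refine mem_topologicalClosure_of_mFourier_eq_one _ fun m hm => ?_
    suffices ∑ i, m i * θ i = 0 by
      simp only [mFourier_apply_eq_prod_toCircle, toCircle_y, h m this, Circle.coe_one]
    by_contra hne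
    have hexp (t : ℝ) : ∏ i, Circle.exp (t * θ i) ^ m i = Circle.exp (t * ∑ i, m i * θ i) := by
      simp only [← Circle.exp_zsmul, Finset.mul_sum, zsmul_eq_mul, mul_left_comm t]
      exact (map_sum Circle.expHom _ _).symm
    have hpi := hm _ ⟨Real.pi / ∑ i, m i * θ i, rfl⟩
    simp only [mFourier_apply_eq_prod_toCircle, toCircle_flow, hexp, div_mul_cancel₀ _ hne,
      Circle.coe_eq_one] at hpi
    exact Circle.exp_pi_ne_one hpi
  obtain ⟨u, hu, hlim⟩ := mem_closure_iff_seq_limit.1 hmem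
  choose t ht using hu
  refine ⟨t, fun i => ?_⟩
  have := ((AddCircle.homeomorphCircle one_ne_zero).continuous.tendsto _).comp
    (tendsto_pi_nhds.1 hlim i)
  simpa only [Function.comp_def, AddCircle.homeomorphCircle_apply, ← ht, toCircle_flow, toCircle_y]
    using this

end Kronecker

section Parity

open Polynomial

variable {K : Type*} [Field K] [CharZero K] {ζ : K}

/-- Modulo `p`, the minimal polynomial of `ζ` is a power of `X - 1`. -/
theorem prime_dvd_coeff_taylor_one_of_aeval_eq_zero {p k : ℕ} [hp : Fact p.Prime] (hk : k ≠ 0)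
    (hζ : IsPrimitiveRoot ζ (p ^ k)) {P : ℤ[X]} (hP : aeval ζ P = 0) {r : ℕ}
    (hr : r < p ^ k - p ^ (k - 1)) : (p : ℤ) ∣ (taylor 1 P).coeff r := by
  have hpos : 0 < p ^ k := pow_pos hp.out.pos k
  have hdvd : cyclotomic (p ^ k) ℤ ∣ P := by
    rw [cyclotomic_eq_minpoly hζ hpos]
    exact minpoly.isIntegrallyClosed_dvd (hζ.isIntegral hpos) hP
  have hcyclotomic : taylor 1 (cyclotomic (p ^ k) (ZMod p)) = X ^ (p ^ k - p ^ (k - 1)) := by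
    have := cyclotomic_mul_prime_pow_eq (ZMod p) hp.out.not_dvd_one (Nat.pos_of_ne_zero hk)
    rw [mul_one, cyclotomic_one] at this
    simp [this, taylor_pow]
  have hdvd_mod : X ^ (p ^ k - p ^ (k - 1)) ∣ taylor 1 (P.map (Int.castRingHom (ZMod p))) := by
    obtain ⟨Q, rfl⟩ := hdvd
    rw [Polynomial.map_mul, map_cyclotomic, taylor_mul, hcyclotomic]
    exact dvd_mul_right _ _
  have := X_pow_dvd_iff.1 hdvd_mod r hr
  rwa [← map_one (Int.castRingHom (ZMod p)), ← map_taylor, coeff_map, eq_intCast,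
    ZMod.intCast_zmod_eq_zero_iff_dvd] at this

theorem prime_dvd_sum_mul_choose_of_sum_mul_pow_eq {ι : Type*} [Fintype ι] {p k : ℕ}
    [Fact p.Prime] (hk : k ≠ 0) (hζ : IsPrimitiveRoot ζ (p ^ k)) {m : ι → ℤ} {e : ι → ℕ} {c : ℤ}
    (h : ∑ i, m i * ζ ^ e i = c) {r : ℕ} (hr₀ : r ≠ 0) (hr : r < p ^ k - p ^ (k - 1)) :
    (p : ℤ) ∣ ∑ i, m i * (e i).choose r := by
  have hP : aeval ζ (∑ i, m i • X ^ e i - C c : ℤ[X]) = 0 := by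
    simp [h]
  have := prime_dvd_coeff_taylor_one_of_aeval_eq_zero hk hζ hP hr
  simpa only [map_sub, map_sum, map_zsmul, taylor_X_pow, taylor_C, C_1, coeff_sub,
    finsetSum_coeff, coeff_smul, coeff_X_add_one_pow, coeff_C_of_ne_zero hr₀, sub_zero,
    smul_eq_mul, nsmul_eq_mul] using this

theorem even_choose_two_add_choose_two_sub {N : ℕ} (hN : 4 ∣ N) (hN₀ : N ≠ 0) (e : ℕ) :
    Even ((e.choose 2 + ((N - 1) * e).choose 2 : ℤ) - e) := by
  obtain ⟨q, rfl⟩ := hN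
  have two_mul_choose_two (n : ℕ) : 2 * (n.choose 2 : ℤ) = n * (n - 1) := by
    have := Nat.cast_choose_two ℚ n
    rw [eq_div_iff two_ne_zero, mul_comm] at this
    exact_mod_cast this
  have hsum : (e.choose 2 + ((4 * q - 1) * e).choose 2 : ℤ) - e
      = e * (e - 1) + 2 * (e ^ 2 * (4 * q ^ 2 - 2 * q) - q * e) := by
    have h₁ := two_mul_choose_two e
    have h₂ := two_mul_choose_two ((4 * q - 1) * e)
    push_cast [show 1 ≤ 4 * q by omega] at h₂
    linarith
  rw [hsum]
  exact (Int.even_mul_pred_self _).add (even_two_mul _)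

theorem even_sum_mul_of_sum_mul_pow_add_inv_eq {ι : Type*} [Fintype ι] {k : ℕ} (hk : 2 ≤ k)
    (hζ : IsPrimitiveRoot ζ (2 ^ (k + 1))) {m : ι → ℤ} {e : ι → ℕ} {c : ℤ}
    (h : ∑ i, m i * (ζ ^ e i + (ζ ^ e i)⁻¹) = c) : Even (∑ i, m i * e i) := by
  set N := 2 ^ (k + 1)
  have hN₀ : N ≠ 0 := pow_ne_zero _ two_ne_zero
  have hN₄ : 4 ∣ N := pow_dvd_pow 2 (by omega : 2 ≤ k + 1)
  have hk₄ : 2 ^ 2 ≤ 2 ^ k := Nat.pow_le_pow_right two_pos hk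
  have hinv (i : ι) : (ζ ^ e i)⁻¹ = ζ ^ ((N - 1) * e i) := by
    refine inv_eq_of_mul_eq_one_right ?_
    rw [← pow_add, ← one_add_mul, Nat.add_sub_cancel' Nat.one_le_two_pow, pow_mul, hζ.pow_eq_one,
      one_pow]
  have hrelation : ∑ i : ι ⊕ ι, (Sum.elim m m i : ℤ) *
      ζ ^ (Sum.elim e (fun i => (N - 1) * e i) i) = c := by
    simp [← h, hinv, mul_add, Finset.sum_add_distrib]
  have hchoose := prime_dvd_sum_mul_choose_of_sum_mul_pow_eq (Nat.succ_ne_zero k) hζ hrelation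
    two_ne_zero (by rw [Nat.succ_eq_add_one, Nat.add_sub_cancel, pow_succ]; omega)
  have hparity : Even (∑ i, m i * (((e i).choose 2 + ((N - 1) * e i).choose 2 : ℤ) - e i)) :=
    Finset.even_sum _ fun i _ => (even_choose_two_add_choose_two_sub hN₄ hN₀ _).mul_left _
  simp only [Fintype.sum_sum_type, Sum.elim_inl, Sum.elim_inr] at hchoose
  simp only [mul_sub, mul_add, Finset.sum_sub_distrib, Finset.sum_add_distrib] at hparity
  exact (Int.even_sub.1 hparity).1 (even_iff_two_dvd.2 hchoose)

end Parity

section Spectral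

variable {V : Type*} [Fintype V] [DecidableEq V]

open scoped Matrix.Norms.Operator in
theorem exp_mulVec_of_mulVec_eq_smul {M : Matrix V V ℂ} {w : V → ℂ} {μ : ℂ}
    (h : M *ᵥ w = μ • w) : NormedSpace.exp M *ᵥ w = Complex.exp μ • w := by
  have hpow (m : ℕ) : M ^ m *ᵥ w = μ ^ m • w := by
    induction m with
    | zero => simp
    | succ m ih => rw [pow_succ, ← Matrix.mulVec_mulVec, h, Matrix.mulVec_smul, ih, smul_smul,
        pow_succ']
  have hexp := (NormedSpace.exp_series_hasSum_exp' (𝕂 := ℂ) M).map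
    (Matrix.mulVecBilin ℂ ℂ |>.flip w) (by
      change Continuous fun A : Matrix V V ℂ => A *ᵥ w
      fun_prop)
  have hexp_smul := (NormedSpace.exp_series_hasSum_exp' (𝕂 := ℂ) μ).smul_const w
  rw [← Complex.exp_eq_exp_ℂ] at hexp_smul
  refine hexp.unique (hexp_smul.congr_fun fun m => ?_)
  simp [hpow, smul_smul]

open Classical in
theorem transitionMatrix_mulVec_of_adjMatrix_mulVec_eq_smul {Γ : SimpleGraph V} {w : V → ℂ}
    {θ : ℂ} (h : Γ.adjMatrix ℂ *ᵥ w = θ • w) (t : ℝ) :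
    transitionMatrix Γ t *ᵥ w = Complex.exp (Complex.I * t * θ) • w :=
  exp_mulVec_of_mulVec_eq_smul (by rw [Matrix.smul_mulVec, h, smul_smul])

theorem HasPGST.hasPGFR {Γ : SimpleGraph V} {u v : V} (h : HasPGST Γ u v) : HasPGFR Γ u v := by
  obtain ⟨t, γ, hγ, ht⟩ := h
  refine ⟨t, 0, γ, by simp [hγ], ?_, by simpa using ht⟩
  rintro rfl
  simp at hγ

open Classical in
theorem hasPGST_of_int_relations {Γ : SimpleGraph V} {u v : V} {ι : Type*} [Fintype ι]
    {w : ι → V → ℂ} {θ : ι → ℝ} {z : ι → ℂ}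
    (hw : ∀ i, Γ.adjMatrix ℂ *ᵥ w i = (θ i : ℂ) • w i) (hu : stdVec u = ∑ i, w i)
    (hv : stdVec v = ∑ i, z i • w i) (hz : ∀ i, ‖z i‖ = 1)
    (hrel : ∀ m : ι → ℤ, ∑ i, m i * θ i = 0 → ∏ i, z i ^ m i = 1) :
    HasPGST Γ u v := by
  obtain ⟨z, rfl⟩ : ∃ z' : ι → Circle, (fun i => (z' i : ℂ)) = z :=
    ⟨fun i => ⟨z i, mem_sphere_zero_iff_norm.2 (hz i)⟩, rfl⟩
  obtain ⟨t, ht⟩ := exists_tendsto_circleExp_mul θ z fun m hm => by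
    rw [← Circle.coe_eq_one, ← hrel m hm]
    exact map_prod Circle.coeHom (fun i => z i ^ m i) _
  refine ⟨t, 1, norm_one, ?_⟩
  rw [one_smul, hv, hu]
  have hphase (i : ι) : Tendsto (fun l => (Circle.exp (t l * θ i) : ℂ)) atTop (𝓝 (z i)) :=
    (continuous_induced_dom.tendsto (z i)).comp (ht i)
  refine (tendsto_finsetSum _ fun i _ => (hphase i).smul_const (w i)).congr fun l => ?_
  rw [Matrix.mulVec_sum]
  refine Finset.sum_congr rfl fun i _ => ?_
  rw [transitionMatrix_mulVec_of_adjMatrix_mulVec_eq_smul (hw i), Circle.coe_exp,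
    Complex.ofReal_mul, mul_comm, mul_assoc]

end Spectral

section CharacterSums

variable {A R : Type*} [AddCommGroup A] [Fintype A] [CommRing R] [IsDomain R]

theorem sum_addSubgroup_mem_range_intCast (H : AddSubgroup A) [DecidablePred (· ∈ H)]
    (ψ : AddChar A R) : ∑ s with s ∈ H, ψ s ∈ (Int.castRingHom R).range := by
  classical
  have hrestrict : ∑ s with s ∈ H, ψ s = ∑ s : H, ψ.compAddMonoidHom H.subtype s :=
    Finset.sum_subtype _ (by simp) _
  rw [hrestrict, AddChar.sum_eq_ite]
  split_ifs
  · exact natCast_mem _ _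
  · exact zero_mem _

theorem sum_addOrderOf_eq_mem_range_intCast (ψ : AddChar A R) (d : ℕ) :
    ∑ s with addOrderOf s = d, ψ s ∈ (Int.castRingHom R).range := by
  classical
  induction d using Nat.strong_induction_on with
  | h d ih =>
    obtain rfl | hd := eq_or_ne d 0
    · simp [(addOrderOf_pos _).ne']
    have htorsion := sum_addSubgroup_mem_range_intCast (AddSubgroup.torsionBy A d) ψ
    have hmem (s : A) : s ∈ AddSubgroup.torsionBy A d ↔ addOrderOf s ∈ d.divisors := by
      rw [Nat.mem_divisors, and_iff_left hd, addOrderOf_dvd_iff_nsmul_eq_zero, ← natCast_zsmul]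
      rfl
    simp only [hmem] at htorsion
    rw [← Finset.sum_fiberwise_eq_sum_filter, ← Nat.cons_self_properDivisors hd,
      Finset.sum_cons] at htorsion
    exact (add_mem_cancel_right (sum_mem fun e he => ih e (Nat.mem_properDivisors.1 he).2)).1
      htorsion

theorem sum_addOrderOf_mem_mem_range_intCast (ψ : AddChar A R) (D : Finset ℕ) :
    ∑ s with addOrderOf s ∈ D, ψ s ∈ (Int.castRingHom R).range := by
  rw [← Finset.sum_fiberwise_eq_sum_filter]
  exact sum_mem fun d _ => sum_addOrderOf_eq_mem_range_intCast ψ d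

end CharacterSums

theorem addOrderOf_eq_iff_exists_coprime {N d e : ℕ} (hN₀ : N ≠ 0) (hN : N = d * e)
    {s : ZMod N} : addOrderOf s = e ↔ ∃ z < e, z.Coprime e ∧ s = (d * z : ℕ) := by
  have hd : 0 < d := Nat.pos_of_ne_zero (left_ne_zero_of_mul (hN ▸ hN₀))
  have he : 0 < e := Nat.pos_of_ne_zero (right_ne_zero_of_mul (hN ▸ hN₀))
  constructor
  · intro hs
    have : NeZero N := ⟨hN₀⟩
    rw [← ZMod.natCast_zmod_val s, ZMod.addOrderOf_coe _ hN₀] at hs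
    have hgcd : N.gcd s.val = d := by
      rw [← Nat.div_div_self (Nat.gcd_dvd_left N s.val) hN₀, hs, hN, Nat.mul_div_cancel _ he]
    obtain ⟨z, hz⟩ : d ∣ s.val := hgcd ▸ Nat.gcd_dvd_right N s.val
    rw [hz, hN, Nat.gcd_mul_left] at hgcd
    refine ⟨z, ?_, ?_, ?_⟩
    · have := hz ▸ s.val_lt
      rw [hN] at this
      exact lt_of_mul_lt_mul_left' this
    · exact Nat.coprime_comm.1 (mul_eq_left₀ hd.ne' |>.1 hgcd)
    · rw [← hz, ZMod.natCast_zmod_val]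
  · rintro ⟨z, -, hz, rfl⟩
    rw [ZMod.addOrderOf_coe _ hN₀, hN, Nat.gcd_mul_left, hz.symm.gcd_eq_one, mul_one,
      Nat.mul_div_cancel_left _ hd]

theorem exists_addChar_natCast_eq_pow {R : Type*} [CommRing R] [IsDomain R] {N : ℕ} [NeZero N]
    {ζ : R} (hζ : IsPrimitiveRoot ζ N) (ψ : AddChar (ZMod N) R) :
    ∃ e : ℕ, ∀ m : ℕ, ψ m = ζ ^ (e * m) := by
  have hone : ψ 1 ^ N = 1 := by
    rw [← AddChar.map_nsmul_eq_pow, nsmul_one, ZMod.natCast_self, AddChar.map_zero_eq_one]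
  obtain ⟨e, -, he⟩ := hζ.eq_pow_of_pow_eq_one hone
  refine ⟨e, fun m => ?_⟩
  rw [pow_mul, he, ← AddChar.map_nsmul_eq_pow, nsmul_one]

theorem addChar_add_inv_eq_ofReal {A : Type*} [AddCommGroup A] [Finite A] (ψ : AddChar A ℂ)
    (s : A) : ψ s + (ψ s)⁻¹ = (2 * (ψ s).re : ℝ) := by
  rw [← AddChar.map_neg_eq_inv, AddChar.map_neg_eq_conj, Complex.add_conj]

theorem prod_zpow_eq_zpow_sum₀ {G₀ ι : Type*} [CommGroupWithZero G₀] {x : G₀} (hx : x ≠ 0)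
    (s : Finset ι) (f : ι → ℤ) : ∏ i ∈ s, x ^ f i = x ^ ∑ i ∈ s, f i := by
  induction s using Finset.cons_induction with
  | empty => simp
  | cons i s hi ih => rw [Finset.prod_cons, Finset.sum_cons, zpow_add₀ hx, ih]

theorem prod_addChar_zpow_eq_one_of_sum_mul_add_inv_eq {K : Type*} [Field K] [CharZero K] {k : ℕ}
    (hk : 2 ≤ k) {ζ : K} (hζ : IsPrimitiveRoot ζ (2 * 2 ^ k)) {k₁ : ℕ} (hk₁ : Odd k₁) {ι : Type*}
    [Fintype ι] {ψ : ι → AddChar (ZMod (2 * 2 ^ k)) K} {m : ι → ℤ} {c : ℤ}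
    (h : ∑ i, m i * (ψ i k₁ + (ψ i k₁)⁻¹) = c) : ∏ i, ψ i (2 ^ k : ℕ) ^ m i = 1 := by
  choose e he using fun i => exists_addChar_natCast_eq_pow hζ (ψ i)
  have hζ_half : ζ ^ 2 ^ k = -1 := (hζ.pow (by positivity) (mul_comm _ _)).eq_neg_one_of_two_right
  simp only [he] at h
  have heven := even_sum_mul_of_sum_mul_pow_add_inv_eq hk (pow_succ' 2 k ▸ hζ) h
  push_cast at heven
  simp only [← mul_assoc, ← Finset.sum_mul] at heven
  have heven_sum : Even (∑ i, m i * e i) :=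
    (Int.even_mul.1 heven).resolve_right (by simpa using hk₁)
  calc ∏ i, ψ i (2 ^ k : ℕ) ^ m i = ∏ i, (-1 : K) ^ (m i * e i) :=
        Finset.prod_congr rfl fun i _ => by
          rw [he, mul_comm (e i), pow_mul, hζ_half, mul_comm (m i), zpow_mul, zpow_natCast]
    _ = (-1) ^ ∑ i, m i * (e i : ℤ) := prod_zpow_eq_zpow_sum₀ (neg_ne_zero.2 one_ne_zero) _ _
    _ = 1 := heven_sum.neg_one_zpow

section Cayley

variable {G : Type*} [Group G] {S : Set G}

theorem cayleyGraph_adj (h_one : 1 ∉ S) (h_inv : ∀ s ∈ S, s⁻¹ ∈ S) {g h : G} :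
    (cayleyGraph S).Adj g h ↔ h * g⁻¹ ∈ S := by
  have hrel (g h : G) : (∃ s ∈ S, s * g = h) ↔ h * g⁻¹ ∈ S := by
    simp [← eq_mul_inv_iff_mul_eq]
  have hsymm : g * h⁻¹ ∈ S → h * g⁻¹ ∈ S := fun hs => by simpa using h_inv _ hs
  simp only [cayleyGraph, SimpleGraph.fromRel_adj, hrel]
  refine ⟨fun hadj => hadj.2.elim id hsymm, fun hs => ⟨?_, Or.inl hs⟩⟩
  rintro rfl
  exact h_one (by simpa using hs)

open Classical in
theorem adjMatrix_cayleyGraph_mulVec_apply [Fintype G] (h_one : 1 ∉ S)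
    (h_inv : ∀ s ∈ S, s⁻¹ ∈ S) {R : Type*} [NonAssocSemiring R] (f : G → R) (g : G) :
    ((cayleyGraph S).adjMatrix R *ᵥ f) g = ∑ s with s ∈ S, f (s * g) := by
  simp only [Matrix.mulVec, dotProduct, SimpleGraph.adjMatrix_apply, cayleyGraph_adj h_one h_inv,
    ite_mul, one_mul, zero_mul, Finset.sum_filter]
  exact (Fintype.sum_equiv (Equiv.mulRight g) _ _ fun s => by simp).symm

end Cayley

section Dicyclic

open QuaternionGroup

variable {n : ℕ}

theorem sum_quaternionGroup [NeZero n] {M : Type*} [AddCommMonoid M] (f : QuaternionGroup n → M) :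
    ∑ g, f g = ∑ i, f (a i) + ∑ i, f (xa i) := by
  let e : ZMod (2 * n) ⊕ ZMod (2 * n) ≃ QuaternionGroup n :=
    { toFun := Sum.elim a xa
      invFun
        | a i => Sum.inl i
        | xa i => Sum.inr i
      left_inv := by rintro (_ | _) <;> rfl
      right_inv := by rintro (_ | _) <;> rfl }
  rw [← e.sum_comp, Fintype.sum_sum_type]
  rfl

theorem genA_pow (n i : ℕ) : genA n ^ i = a i :=
  a_one_pow i

theorem cosetB_eq_range_xa (n : ℕ) : cosetB n = Set.range xa := by
  have genA_zpow (i : ℤ) : genA n ^ i = a i := by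
    cases i with
    | ofNat i => simpa using genA_pow n i
    | negSucc i =>
      rw [zpow_negSucc, genA_pow, Int.cast_negSucc]
      rfl
  ext g
  constructor
  · rintro ⟨x, ⟨i, rfl⟩, rfl⟩
    exact ⟨-i, by simp [genA_zpow, genB]⟩
  · rintro ⟨s, rfl⟩
    obtain ⟨i, rfl⟩ := ZMod.intCast_surjective s
    exact ⟨genA n ^ (-i), Subgroup.zpow_mem_zpowers _ _, by simp [genA_zpow, genB, -zpow_neg]⟩

/-- The extension by the sign `ε` of a character of `⟨a⟩` to the dicyclic group. It need not be a
character; it serves as a joint eigenvector of all Cayley graphs with connection set `T ∪ ⟨a⟩b`,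
where `T ⊆ ⟨a⟩ \ {1}` is inverse-closed. -/
def extendChar (ψ : AddChar (ZMod (2 * n)) ℂ) (ε : ℤˣ) : QuaternionGroup n → ℂ
  | a i => ψ i
  | xa i => (ε : ℤ) * ψ i

@[simp]
theorem extendChar_a (ψ : AddChar (ZMod (2 * n)) ℂ) (ε : ℤˣ) (i : ZMod (2 * n)) :
    extendChar ψ ε (a i) = ψ i :=
  rfl

@[simp]
theorem extendChar_xa (ψ : AddChar (ZMod (2 * n)) ℂ) (ε : ℤˣ) (i : ZMod (2 * n)) :
    extendChar ψ ε (xa i) = (ε : ℤ) * ψ i :=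
  rfl

variable [NeZero n]

open Classical in
theorem adjMatrix_cayleyGraph_union_cosetB_mulVec_apply {T : Finset (ZMod (2 * n))}
    (h_zero : 0 ∉ T) (h_neg : ∀ s ∈ T, -s ∈ T) (f : QuaternionGroup n → ℂ)
    (g : QuaternionGroup n) :
    ((cayleyGraph (a '' T ∪ cosetB n)).adjMatrix ℂ *ᵥ f) g
      = ∑ s ∈ T, f (a s * g) + ∑ i, f (xa i * g) := by
  rw [adjMatrix_cayleyGraph_mulVec_apply, Finset.sum_filter, sum_quaternionGroup]
  · simp [cosetB_eq_range_xa]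
  · simp [cosetB_eq_range_xa, one_def, -a_zero, h_zero]
  · rw [cosetB_eq_range_xa]
    rintro _ (⟨s, hs, rfl⟩ | ⟨i, rfl⟩)
    · exact Or.inl ⟨-s, h_neg s hs, rfl⟩
    · exact Or.inr ⟨n + i, rfl⟩

open Classical in
theorem adjMatrix_cayleyGraph_mulVec_extendChar {T : Finset (ZMod (2 * n))} (h_zero : 0 ∉ T)
    (h_neg : ∀ s ∈ T, -s ∈ T) (ψ : AddChar (ZMod (2 * n)) ℂ) (ε : ℤˣ) :
    (cayleyGraph (a '' T ∪ cosetB n)).adjMatrix ℂ *ᵥ extendChar ψ ε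
      = (∑ s ∈ T, ψ s + (ε : ℤ) * ∑ i, ψ i) • extendChar ψ ε := by
  have hsum_neg : ∑ s ∈ T, ψ (-s) = ∑ s ∈ T, ψ s :=
    Finset.sum_nbij' (-·) (-·) h_neg h_neg (by simp) (by simp) (by simp)
  have hsum_sub (j : ZMod (2 * n)) : ∑ i, ψ (j - i) = ∑ i, ψ i :=
    (Equiv.subLeft j).sum_comp ψ
  have hsum_mul (j : ZMod (2 * n)) : (∑ i, ψ i) * ψ j = ∑ i, ψ i := by
    simp only [Finset.sum_mul, ← AddChar.map_add_eq_mul]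
    exact Fintype.sum_equiv (Equiv.addRight j) _ _ fun _ => rfl
  have hε : ((ε : ℤ) : ℂ) * (ε : ℤ) = 1 := by
    exact_mod_cast Int.units_coe_mul_self ε
  ext (j | j)
  · simp only [adjMatrix_cayleyGraph_union_cosetB_mulVec_apply h_zero h_neg, a_mul_a, xa_mul_a,
      extendChar_a, extendChar_xa, AddChar.map_add_eq_mul, ← Finset.mul_sum, ← Finset.sum_mul,
      Pi.smul_apply, smul_eq_mul]
    ring
  · have hT : ∑ s ∈ T, ψ (j - s) = (∑ s ∈ T, ψ s) * ψ j := by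
      simp only [← hsum_neg, Finset.sum_mul, ← AddChar.map_add_eq_mul, neg_add_eq_sub]
    simp only [adjMatrix_cayleyGraph_union_cosetB_mulVec_apply h_zero h_neg, a_mul_xa, xa_mul_xa,
      extendChar_a, extendChar_xa, ← Finset.mul_sum, hT, hsum_sub, Pi.smul_apply, smul_eq_mul]
    linear_combination (-∑ i, ψ i) * hε - (ε : ℤ) * (ε : ℤ) * hsum_mul j

theorem stdVec_a_eq_sum_extendChar (c : ZMod (2 * n)) :
    stdVec (a c) = ∑ p : AddChar (ZMod (2 * n)) ℂ × ℤˣ,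
      p.1 (-c) • (4 * n : ℂ)⁻¹ • extendChar p.1 p.2 := by
  have hn : (n : ℂ) ≠ 0 := Nat.cast_ne_zero.2 (NeZero.ne n)
  ext (i | i)
  · have hsum : ∑ ψ : AddChar (ZMod (2 * n)) ℂ, ψ (-c) * ψ i
        = if c = i then (2 * n : ℂ) else 0 := by
      simp only [← AddChar.map_add_eq_mul, AddChar.sum_apply_eq_ite, neg_add_eq_zero, ZMod.card,
        Nat.cast_mul, Nat.cast_ofNat]
    calc stdVec (a c) (a i) = (4 * n : ℂ)⁻¹ * (2 * if c = i then (2 * n : ℂ) else 0) := by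
          simp only [stdVec, Pi.single_apply, a.injEq, eq_comm (a := i)]
          split_ifs
          · field_simp
            norm_num
          · simp
      _ = _ := by
          rw [← hsum]
          simp [Fintype.sum_prod_type, Finset.mul_sum, mul_comm, mul_left_comm]
  · simp [stdVec, Fintype.sum_prod_type]

theorem hasPGST_cayleyGraph_of_sum_addChar_eq {k : ℕ} (hk : 2 ≤ k) {k₁ : ℕ} (hk₁ : Odd k₁)
    {T : Finset (ZMod (2 * 2 ^ k))} (h_zero : 0 ∉ T) (h_neg : ∀ s ∈ T, -s ∈ T)
    (hT : ∀ ψ : AddChar (ZMod (2 * 2 ^ k)) ℂ, ∃ c : ℤ, ∑ s ∈ T, ψ s = ψ k₁ + (ψ k₁)⁻¹ + c) :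
    HasPGST (cayleyGraph (a '' T ∪ cosetB (2 ^ k))) (a 0) (a (2 ^ k : ℕ)) := by
  have heigenvalue (p : AddChar (ZMod (2 * 2 ^ k)) ℂ × ℤˣ) : ∃ c : ℤ,
      ∑ s ∈ T, p.1 s + (p.2 : ℤ) * ∑ i, p.1 i = (2 * (p.1 k₁).re + c : ℝ) := by
    obtain ⟨c, hc⟩ := hT p.1
    refine ⟨c + p.2 * if p.1 = 0 then (2 * 2 ^ k : ℕ) else 0, ?_⟩
    rw [hc, AddChar.sum_eq_ite, addChar_add_inv_eq_ofReal]
    split_ifs <;> simp [add_assoc]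
  choose c hc using heigenvalue
  have hneg : -((2 ^ k : ℕ) : ZMod (2 * 2 ^ k)) = (2 ^ k : ℕ) := by
    rw [neg_eq_iff_add_eq_zero, ← Nat.cast_add, ← two_mul, ZMod.natCast_self]
  refine hasPGST_of_int_relations (ι := AddChar (ZMod (2 * 2 ^ k)) ℂ × ℤˣ)
    (w := fun p => (4 * (2 ^ k : ℕ) : ℂ)⁻¹ • extendChar p.1 p.2)
    (θ := fun p => 2 * (p.1 k₁).re + c p) (z := fun p => p.1 (2 ^ k : ℕ)) (fun p => ?_) ?_ ?_
    (fun p => AddChar.norm_apply _ _) fun m hm => ?_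
  · rw [Matrix.mulVec_smul, adjMatrix_cayleyGraph_mulVec_extendChar h_zero h_neg, hc, smul_comm]
  · simp only [stdVec_a_eq_sum_extendChar, neg_zero, AddChar.map_zero_eq_one, one_smul]
  · simp only [stdVec_a_eq_sum_extendChar, hneg]
  · have hrelation : ∑ p, m p * (p.1 k₁ + (p.1 k₁)⁻¹) = (-∑ p, m p * c p : ℤ) := by
      simp only [addChar_add_inv_eq_ofReal]
      rw [← sub_eq_zero]
      push_cast
      rw [sub_neg_eq_add, ← Finset.sum_add_distrib, ← Complex.ofReal_zero, ← hm]
      push_cast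
      simp only [mul_add]
    exact prod_addChar_zpow_eq_one_of_sum_mul_add_inv_eq hk
      (Complex.isPrimitiveRoot_exp _ (by positivity)) hk₁ hrelation

theorem hasPGST_cayleyGraph_of_addOrderOf {k : ℕ} (hk : 2 ≤ k) {k₁ : ℕ} (hk₁ : Odd k₁)
    {D : Finset ℕ} (h_one : 1 ∉ D) (h_card : 2 * 2 ^ k ∉ D) :
    HasPGST (cayleyGraph ({genA (2 ^ k) ^ k₁, (genA (2 ^ k) ^ k₁)⁻¹}
      ∪ a '' {s | addOrderOf s ∈ D} ∪ cosetB (2 ^ k))) (a 0) (a (2 ^ k : ℕ)) := by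
  have horder : addOrderOf (k₁ : ZMod (2 * 2 ^ k)) = 2 * 2 ^ k := by
    have hcoprime : (2 * 2 ^ k).Coprime k₁ := pow_succ' 2 k ▸ hk₁.coprime_two_left.pow_left _
    rw [ZMod.addOrderOf_coe _ (by positivity), hcoprime.gcd_eq_one, Nat.div_one]
  have hk₁_ne_neg : (k₁ : ZMod (2 * 2 ^ k)) ≠ -k₁ := by
    intro h
    rw [eq_neg_iff_add_eq_zero, ← two_nsmul] at h
    have hle := Nat.le_of_dvd two_pos (horder ▸ addOrderOf_dvd_of_nsmul_eq_zero h)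
    have hk₄ : 2 ^ 2 ≤ 2 ^ k := Nat.pow_le_pow_right two_pos hk
    omega
  have hk₁_ne_zero : (k₁ : ZMod (2 * 2 ^ k)) ≠ 0 := fun h => hk₁_ne_neg (by rw [h, neg_zero])
  let P : Finset (ZMod (2 * 2 ^ k)) := {(k₁ : ZMod (2 * 2 ^ k)), -(k₁ : ZMod (2 * 2 ^ k))}
  let Q : Finset (ZMod (2 * 2 ^ k)) := {s | addOrderOf s ∈ D}
  have hdisjoint : Disjoint P Q := by simp [P, Q, horder, h_card]
  have himage : ({genA (2 ^ k) ^ k₁, (genA (2 ^ k) ^ k₁)⁻¹} ∪ a '' {s | addOrderOf s ∈ D} :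
      Set (QuaternionGroup (2 ^ k))) = a '' (P ∪ Q : Finset _) := by
    rw [Finset.coe_union, Set.image_union, Finset.coe_pair, Set.image_pair, Finset.coe_filter_univ,
      genA_pow]
    rfl
  rw [himage]
  refine hasPGST_cayleyGraph_of_sum_addChar_eq hk hk₁ ?_ (fun s hs => ?_) fun ψ => ?_
  · simp [P, Q, h_one, hk₁_ne_zero, hk₁_ne_zero.symm]
  · simp only [P, Q, Finset.mem_union, Finset.mem_insert, Finset.mem_singleton,
      Finset.mem_filter_univ, addOrderOf_neg, neg_eq_iff_eq_neg, neg_neg] at hs ⊢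
    tauto
  · obtain ⟨c, hc⟩ := sum_addOrderOf_mem_mem_range_intCast ψ D
    refine ⟨c, ?_⟩
    rw [Finset.sum_union hdisjoint, Finset.sum_pair hk₁_ne_neg, AddChar.map_neg_eq_inv, ← hc]
    rfl

theorem a_zero_ne_a_natCast (n : ℕ) [NeZero n] : (a 0 : QuaternionGroup n) ≠ a (n : ℕ) := by
  rw [Ne, a.injEq, eq_comm, ZMod.natCast_eq_zero_iff]
  have hn := NeZero.pos n
  exact Nat.not_dvd_of_pos_of_lt hn (by omega)

theorem setOf_eq_genA_pow_odd_mul_eq_image_addOrderOf {k m : ℕ} (hm : m ≤ k) :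
    {g | ∃ z : ℕ, Nat.gcd z 2 = 1 ∧ 1 ≤ z ∧ z ≤ 2 ^ (k - m + 1) - 1 ∧
      g = genA (2 ^ k) ^ (2 ^ m * z)} = a '' {s | addOrderOf s = 2 ^ (k - m + 1)} := by
  have hfactor : 2 * 2 ^ k = 2 ^ m * 2 ^ (k - m + 1) := by
    rw [← pow_succ', ← pow_add]
    congr 1
    omega
  have hcoprime (z : ℕ) : z.Coprime (2 ^ (k - m + 1)) ↔ z.gcd 2 = 1 :=
    Nat.coprime_pow_right_iff (Nat.succ_pos _) _ _
  ext g
  simp only [Set.mem_ofPred_eq, Set.mem_image, genA_pow, hcoprime,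
    addOrderOf_eq_iff_exists_coprime (by positivity : 2 * 2 ^ k ≠ 0) hfactor]
  constructor
  · rintro ⟨z, hz, hz_one, hz_le, rfl⟩
    exact ⟨_, ⟨z, by omega, hz, rfl⟩, rfl⟩
  · rintro ⟨_, ⟨z, hz_lt, hz, rfl⟩, rfl⟩
    have hz₀ : z ≠ 0 := by
      rintro rfl
      simp at hz
    exact ⟨z, hz, by omega, by omega, rfl⟩

theorem iUnion_genA_pow_odd_mul_eq_image_addOrderOf {ι : Type*} [Fintype ι] {k : ℕ} {m : ι → ℕ}
    (hm : ∀ j, m j ≤ k) :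
    ⋃ j, {g | ∃ z : ℕ, Nat.gcd z 2 = 1 ∧ 1 ≤ z ∧ z ≤ 2 ^ (k - m j + 1) - 1 ∧
      g = genA (2 ^ k) ^ (2 ^ m j * z)}
      = a '' {s | addOrderOf s ∈ Finset.univ.image fun j => 2 ^ (k - m j + 1)} := by
  simp only [setOf_eq_genA_pow_odd_mul_eq_image_addOrderOf (hm _), ← Set.image_iUnion]
  congr 1
  ext s
  simp [eq_comm]

end Dicyclic

end QuantumWalk

theorem mainTheorem3 (k : ℕ) (hk : 2 ≤ k)
    (S S₁ : Set (QuaternionGroup (2 ^ k)))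
    (hS : S = S₁ ∪ QuantumWalk.cosetB (2 ^ k))
    (k₁ : ℕ) (hk₁_odd : Odd k₁) (hk₁_one : 1 ≤ k₁) (hk₁_le : k₁ ≤ 2 ^ k - 1)
    (hS₁ :
      S₁ = {QuantumWalk.genA (2 ^ k) ^ k₁, (QuantumWalk.genA (2 ^ k) ^ k₁)⁻¹} ∨
      ∃ (r : ℕ) (m : Fin r → ℕ), StrictMono m ∧ (∀ j, 1 ≤ m j ∧ m j ≤ k) ∧
        S₁ = {QuantumWalk.genA (2 ^ k) ^ k₁, (QuantumWalk.genA (2 ^ k) ^ k₁)⁻¹} ∪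
          ⋃ j : Fin r, {g | ∃ z : ℕ, Nat.gcd z 2 = 1 ∧ 1 ≤ z ∧ z ≤ 2 ^ (k - m j + 1) - 1 ∧
            g = QuantumWalk.genA (2 ^ k) ^ (2 ^ m j * z)}) :
    QuantumWalk.AdmitsPGST (QuantumWalk.cayleyGraph S) ∧
      QuantumWalk.AdmitsPGFR (QuantumWalk.cayleyGraph S) := by
  obtain ⟨D, h_one, h_card, hD⟩ : ∃ D : Finset ℕ, 1 ∉ D ∧ 2 * 2 ^ k ∉ D ∧
      S₁ = {QuantumWalk.genA (2 ^ k) ^ k₁, (QuantumWalk.genA (2 ^ k) ^ k₁)⁻¹} ∪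
        QuaternionGroup.a '' {s | addOrderOf s ∈ D} := by
    rcases hS₁ with hS₁ | ⟨r, m, -, hm, hS₁⟩
    · exact ⟨∅, by simp, by simp, by simp [hS₁]⟩
    · refine ⟨Finset.univ.image fun j => 2 ^ (k - m j + 1), by simp, ?_, ?_⟩
      · have hexponent (j : Fin r) : k - m j ≠ k := by
          have := hm j
          omega
        simp [← pow_succ', hexponent]
      · rw [hS₁, QuantumWalk.iUnion_genA_pow_odd_mul_eq_image_addOrderOf fun j => (hm j).2]
  have hpgst := QuantumWalk.hasPGST_cayleyGraph_of_addOrderOf hk hk₁_odd h_one h_card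
  rw [← hD, ← hS] at hpgst
  have hne := QuantumWalk.a_zero_ne_a_natCast (2 ^ k)
  exact ⟨⟨_, _, hne, hpgst⟩, _, _, hne, hpgst.hasPGFR⟩
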